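/- A structure here is a countable set $A$ with one binary relation $R\subseteq A^2$; $\operatorname{End}(\mathbb A)$ is the monoid (under composition) of all maps $s\colon A\to A$ such that $(a,b)\in R$ implies $(s(a),s(b))\in R$. The *pointwise topology* on $\operatorname{End}(\mathbb A)$ is the subspace topology inherited from the product topology on $A^A$ with $A$ discrete. The *Zariski topology* on a monoid $S$ is the topology generated by all sets $\{s\in S:\varphi(s)\neq\psi(s)\}$, where $\varphi(s)=p_k s p_{k-1}s\cdots s p_0$ and $\psi(s)=q_\ell s q_{\ell-1}s\cdots s q_0$ with $k,\ell\in\mathbb N$, $\ell\le k$, and $p_0,\dots,p_k,q_0,\dots,q_\ell\in S$ (a word with no occurrence of $s$ is a constant). For a class of finite structures, *the random* structure of that kind is its Fraïssé limit, i.e. the countable structure in which every isomorphism between finite substructures extends to an automorphism, and whose finite substructures are, up to isomorphism, exactly the members of the class. Let $\mathbb A$ be (up to isomorphism) one of the following structures: 1. $\langle\mathbb Q,\le\rangle$; 2. the random reflexive partial order; 3. an equivalence relation with at least one, and either finitely or countably infinitely many, equivalence classes, each countably infinite; 4. the random graph with a loop at every vertex, or the random digraph with a loop at every vertex (digraph: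 edges in both directions between two vertices are allowed); 5. for some $n\ge 2$, the random $n$-clique-free graph with a loop at every vertex ($n$-clique-free: there are no $n$ distinct pairwise adjacent vertices); 6. $\langle\mathbb Q,<\rangle$; 7. the random strict partial order; 8. the random tournament; 9. an irreflexive equivalence relation, i.e. the relation "$x\sim y$ and $x\ne y$" for an equivalence relation $\sim$ as in 3; 10. the random graph without loops, or the random digraph without loops; 11. for some $n\ge 2$, the random $n$-clique-free graph without loops. Then the pointwise topology and the Zariski topology on $\operatorname{End}(\mathbb A)$ coincide. In particular, the pointwise topology is the coarsest Hausdorff semigroup topology on $\operatorname{End}(\mathbb A)$: it is Hausdorff and makes composition continuous, and every Hausdorff topology on $\operatorname{End}(\mathbb A)$ for which composition is (jointly) continuous is finer than it. -/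

import Mathlib

universe u

/-! ### Topologies on monoids -/

/-- The word `φ(s) = p k * s * p (k-1) * s * ⋯ * s * p 0` with `k` occurrences of `s`
(only the coefficients `p 0, …, p k` matter); for `k = 0` it is the constant `p 0`. -/
def semigroupWord {S : Type*} [Monoid S] (p : ℕ → S) : ℕ → S → S
  | 0, _ => p 0
  | k + 1, s => p (k + 1) * s * semigroupWord p k s

/-- The Zariski topology on a monoid `S`: the topology generated by all the sets
`M_{φ,ψ} = {s | φ(s) ≠ ψ(s)}`, where `φ(s) = p k * s * ⋯ * s * p 0` and
`ψ(s) = q l * s * ⋯ * s * q 0` with `l ≤ k`. -/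
def zariskiTopology (S : Type*) [Monoid S] : TopologicalSpace S :=
  TopologicalSpace.generateFrom
    {M | ∃ (k l : ℕ) (p q : ℕ → S), l ≤ k ∧
      M = {s | semigroupWord p k s ≠ semigroupWord q l s}}

/-- The pointwise topology on the endomorphism monoid `r →r r` of the structure `(A, r)`:
the subspace topology of the product topology on `A → A`, each factor `A` being discrete. -/
def pointwiseTopology {A : Type u} (r : A → A → Prop) : TopologicalSpace (r →r r) :=
  TopologicalSpace.induced (fun f : r →r r => (f : A → A))
    (@Pi.topologicalSpace A (fun _ => A) (fun _ => ⊥))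

/-! ### Fraïssé limits of classes of finite structures with one binary relation -/

/-- A set with a binary relation `r`, as a first-order structure in the language with exactly
one binary relation symbol. -/
@[reducible]
def relStructure {A : Type u} (r : A → A → Prop) : FirstOrder.Language.graph.Structure A where
  RelMap | .adj => fun x => r (x 0) (x 1)

/-- The class of all finite structures with one binary relation satisfying `P`. -/
def finiteRelClass (P : ∀ B : Type u, (B → B → Prop) → Prop) :
    Set (CategoryTheory.Bundled.{u} FirstOrder.Language.graph.Structure) :=
  {B | Finite B ∧
    P B (fun x y => FirstOrder.Language.Structure.RelMap FirstOrder.Language.adj ![x, y])}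

/-- `(A, r)` is "the random `P`": the countable homogeneous structure whose finite substructures
are, up to isomorphism, exactly the finite structures satisfying `P`. -/
def IsRandom (P : ∀ B : Type u, (B → B → Prop) → Prop) {A : Type u} (r : A → A → Prop) : Prop :=
  ∃ _ : Countable A,
    letI := relStructure r
    FirstOrder.Language.IsFraisseLimit (finiteRelClass P) A

/-! ### The classes of structures -/

/-- Irreflexive symmetric relations: graphs without loops. -/
def IsGraph (B : Type u) (r : B → B → Prop) : Prop :=
  (∀ x, ¬ r x x) ∧ ∀ x y, r x y → r y x

/-- Reflexive symmetric relations: graphs with a loop at every vertex. -/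
def IsLoopedGraph (B : Type u) (r : B → B → Prop) : Prop :=
  (∀ x, r x x) ∧ ∀ x y, r x y → r y x

/-- Irreflexive relations: directed graphs without loops (edges in both directions between
two vertices are allowed). -/
def IsDigraph (B : Type u) (r : B → B → Prop) : Prop :=
  ∀ x, ¬ r x x

/-- Reflexive relations: directed graphs with a loop at every vertex. -/
def IsLoopedDigraph (B : Type u) (r : B → B → Prop) : Prop :=
  ∀ x, r x x

/-- There are no `n` distinct, pairwise adjacent vertices (loops being ignored). -/
def HasNoClique (n : ℕ) (B : Type u) (r : B → B → Prop) : Prop :=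
  (SimpleGraph.fromRel r).CliqueFree n

/-- Tournaments: irreflexive, with exactly one directed edge between distinct vertices. -/
def IsTournamentRel (B : Type u) (r : B → B → Prop) : Prop :=
  (∀ x, ¬ r x x) ∧ ∀ x y, x ≠ y → (r x y ↔ ¬ r y x)

/-- Equivalence relations on a countable set with (at least one and) finitely or countably many
classes, all of them countably infinite. -/
def IsEquivWithInfiniteClasses {A : Type u} (e : A → A → Prop) : Prop :=
  Countable A ∧ Nonempty A ∧ Equivalence e ∧ ∀ a, {b | e a b}.Infinite

/-- The structures `(A, r)` of the list (each one up to isomorphism). -/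
inductive IsListedStructure {A : Type u} (r : A → A → Prop) : Prop
  /-- `(ℚ, ≤)` -/
  | ratLE (h : Nonempty (r ≃r ((· ≤ ·) : ℚ → ℚ → Prop)))
  /-- the random reflexive partial order -/
  | partialOrder (h : IsRandom (fun B s => IsPartialOrder B s) r)
  /-- equivalence relations -/
  | equivalence (h : IsEquivWithInfiniteClasses r)
  /-- the random graph with loops -/
  | loopedGraph (h : IsRandom IsLoopedGraph r)
  /-- the random digraph with loops -/
  | loopedDigraph (h : IsRandom IsLoopedDigraph r)
  /-- the random `n`-clique-free graph with loops -/
  | loopedCliqueFree (n : ℕ) (hn : 2 ≤ n)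
      (h : IsRandom (fun B s => IsLoopedGraph B s ∧ HasNoClique n B s) r)
  /-- `(ℚ, <)` -/
  | ratLT (h : Nonempty (r ≃r ((· < ·) : ℚ → ℚ → Prop)))
  /-- the random strict partial order -/
  | strictPartialOrder (h : IsRandom (fun B s => IsStrictOrder B s) r)
  /-- the random tournament -/
  | tournament (h : IsRandom IsTournamentRel r)
  /-- irreflexive equivalence relations: all pairs of distinct equivalent elements -/
  | irreflEquivalence (e : A → A → Prop) (he : IsEquivWithInfiniteClasses e)
      (h : ∀ x y, r x y ↔ e x y ∧ x ≠ y)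
  /-- the random graph without loops -/
  | graph (h : IsRandom IsGraph r)
  /-- the random digraph without loops -/
  | digraph (h : IsRandom IsDigraph r)
  /-- the random `n`-clique-free graph without loops -/
  | cliqueFree (n : ℕ) (hn : 2 ≤ n)
      (h : IsRandom (fun B s => IsGraph B s ∧ HasNoClique n B s) r)

/-!
The Zariski topology is coarser than every Hausdorff semigroup topology, because words are
continuous for such a topology; and the pointwise topology is a Hausdorff semigroup topology. So
both claims follow once every evaluation fibre `{s | s a = b}` is shown to be Zariski open
(`HasZariskiOpenFibres`).

Let `p` and `q` be endomorphisms that differ exactly at `b`. Then `p s f ≠ q s f` says that `b` lies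
in the range of `s f`. If `f` and `g` are endomorphisms taking the value `a` at a common point, and
`s (f x) = s (g y)` forces `f x = a` for every endomorphism `s`, then `s a = b` is equivalent to the
two inequalities `p s f ≠ q s f` and `p s g ≠ q s g` (`isOpen_zariskiTopology_apply_eq`).

All four endomorphisms come from maps `e : A × Bool → A` on two copies of `A` such that choosing
one copy of each point always yields an endomorphism `x ↦ e (x, φ x)`. If `e` is injective, choices
that differ at `b` only give `p` and `q`. In the reflexive structures (and in the graph without
edges) the constant map with value `a` serves as `f` and `g`. In the other structures `f` and `g` are
choices that meet in `e (a, false) = a` only, for a map `e` that stays injective after composition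
with any endomorphism: the image of `e` is a chain in the case of orders, a tournament in the case of
tournaments, a clique in the case of (di)graphs, and a part of a single class in the case of
equivalence relations. For `n`-clique-free graphs with `3 ≤ n` all endomorphisms are injective
(`IsRandom.injective_of_cliqueFree`).

In random structures the maps `e` are embeddings of suitable relations on `A × Bool`, such as
`twinRel` and `lexRel`; they exist by `IsRandom.exists_embedding`: a countable structure whose
finite substructures are in the class embeds into the Fraïssé limit, and the embedding may
extend any given finite partial embedding.
-/

open Topology

/-! ### Topologies on the endomorphism monoid -/

/-- Words are continuous for a semigroup topology. -/
theorem continuous_semigroupWord {S : Type*} [Monoid S] [TopologicalSpace S] [ContinuousMul S]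
    (p : ℕ → S) (k : ℕ) : Continuous (semigroupWord p k) := by
  induction k with
  | zero => exact continuous_const
  | succ k ih => exact (continuous_const.mul continuous_id).mul ih

theorem le_zariskiTopology {S : Type*} [Monoid S] (τ : TopologicalSpace S) [T2Space S]
    [ContinuousMul S] : τ ≤ zariskiTopology S := by
  refine le_generateFrom ?_
  rintro _ ⟨k, l, p, q, -, rfl⟩
  exact isOpen_ne_fun (continuous_semigroupWord p k) (continuous_semigroupWord q l)

theorem isOpen_zariskiTopology_mul_mul_ne {S : Type*} [Monoid S] (p q f : S) :
    IsOpen[zariskiTopology S] {s | p * s * f ≠ q * s * f} :=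
  TopologicalSpace.isOpen_generateFrom_of_mem
    ⟨1, 1, fun i => if i = 0 then f else p, fun i => if i = 0 then f else q, le_rfl, by
      simp [semigroupWord]⟩

section Pointwise

variable {A : Type u} (r : A → A → Prop)

theorem isOpen_pointwiseTopology_apply_eq (a b : A) :
    IsOpen[pointwiseTopology r] {s : r →r r | s a = b} := by
  let : TopologicalSpace A := ⊥
  have : DiscreteTopology A := ⟨rfl⟩
  exact ⟨(fun f : A → A => f a) ⁻¹' {b},
    (isOpen_discrete {b}).preimage (continuous_apply (A := fun _ : A => A) a), rfl⟩

theorem t2Space_pointwiseTopology : @T2Space (r →r r) (pointwiseTopology r) := by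
  let : TopologicalSpace A := ⊥
  have : DiscreteTopology A := ⟨rfl⟩
  let := pointwiseTopology r
  exact T2Space.of_injective_continuous (f := fun f : r →r r => (f : A → A))
    DFunLike.coe_injective continuous_induced_dom

theorem continuousMul_pointwiseTopology :
    @ContinuousMul (r →r r) (pointwiseTopology r) _ := by
  let : TopologicalSpace A := ⊥
  have : DiscreteTopology A := ⟨rfl⟩
  let := pointwiseTopology r
  refine ⟨continuous_induced_rng.2 (continuous_pi fun a => ?_)⟩
  refine (IsLocallyConstant.iff_exists_open _).2 ?_ |>.continuous
  -- Near `(f, g)`, the value of `f ∘ g` at `a` only depends on `g a` and on `f` at `g a`.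
  rintro ⟨f, g⟩
  refine ⟨{s : r →r r | s (g a) = f (g a)} ×ˢ {s : r →r r | s a = g a},
    (isOpen_pointwiseTopology_apply_eq r _ _).prod (isOpen_pointwiseTopology_apply_eq r _ _),
    ⟨rfl, rfl⟩, ?_⟩
  rintro ⟨f', g'⟩ ⟨h₁, h₂⟩
  change f' (g' a) = f (g a)
  rw [show g' a = g a from h₂, show f' (g a) = f (g a) from h₁]

theorem le_pointwiseTopology_of_isOpen (τ : TopologicalSpace (r →r r))
    (h : ∀ a b, IsOpen[τ] {s : r →r r | s a = b}) : τ ≤ pointwiseTopology r := by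
  let : TopologicalSpace A := ⊥
  have : DiscreteTopology A := ⟨rfl⟩
  refine continuous_iff_le_induced.1 (continuous_pi fun a => continuous_discrete_rng.2 fun b => ?_)
  exact h a b

end Pointwise

/-! ### Sufficient conditions for open evaluation fibres -/

section Fibres

variable {A : Type u} {r : A → A → Prop}

/-- `IsSectionHom r e` says that `e : A × Bool → A`, thought of as a map defined on two copies
of `A`, becomes an endomorphism of `(A, r)` whenever a copy is chosen for each point. -/
def IsSectionHom (r : A → A → Prop) (e : A × Bool → A) : Prop :=
  ∀ (φ : A → Bool) (x y : A), r x y → r (e (x, φ x)) (e (y, φ y))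

/-- All evaluation fibres `{s | s a = b}` are open in the Zariski topology. -/
def HasZariskiOpenFibres (r : A → A → Prop) : Prop :=
  ∀ a b, IsOpen[zariskiTopology (r →r r)] {s : r →r r | s a = b}

/-- The endomorphism `x ↦ e (x, φ x)` selecting the copy `φ x` of the point `x`. -/
def IsSectionHom.toHom {e : A × Bool → A} (he : IsSectionHom r e) (φ : A → Bool) : r →r r :=
  ⟨fun x => e (x, φ x), fun {x y} h => he φ x y h⟩

/-- The evaluation fibre `{s | s a = b}` is Zariski open. If `p` and `q` differ exactly at `b`, then
`p s f ≠ q s f` says that `b` is in the range of `s f`; two homomorphisms `f` and `g`, whose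
ranges every endomorphism separates away from `a`, then detect `s a = b`. -/
theorem isOpen_zariskiTopology_apply_eq {a b c : A} (p q f g : r →r r)
    (hpq : ∀ x, p x = q x ↔ x ≠ b) (hf : f c = a) (hg : g c = a)
    (hfg : ∀ (s : r →r r) (x y : A), s (f x) = s (g y) → f x = a) :
    IsOpen[zariskiTopology (r →r r)] {s : r →r r | s a = b} := by
  have key : ∀ h s : r →r r, p * s * h ≠ q * s * h ↔ ∃ x, s (h x) = b := by
    intro h s
    rw [← not_forall_not, not_iff_not, RelHom.ext_iff]
    exact forall_congr' fun x => hpq (s (h x))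
  have : {s : r →r r | s a = b} = {s | p * s * f ≠ q * s * f} ∩ {s | p * s * g ≠ q * s * g} := by
    ext s
    simp only [Set.mem_ofPred_eq, Set.mem_inter_iff, key]
    constructor
    · intro h
      exact ⟨⟨c, by rw [hf, h]⟩, ⟨c, by rw [hg, h]⟩⟩
    · rintro ⟨⟨x, hx⟩, ⟨y, hy⟩⟩
      rw [← hfg s x y (hx.trans hy.symm), hx]
  rw [this]
  let := zariskiTopology (r →r r)
  exact IsOpen.inter (isOpen_zariskiTopology_mul_mul_ne p q f)
    (isOpen_zariskiTopology_mul_mul_ne p q g)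

open Classical in
theorem IsSectionHom.exists_eq_iff_ne {e : A × Bool → A} (he : IsSectionHom r e)
    (hinj : Function.Injective e) (b : A) :
    ∃ p q : r →r r, ∀ x, p x = q x ↔ x ≠ b := by
  refine ⟨he.toHom fun _ => false, he.toHom fun x => decide (x = b), fun x => ?_⟩
  change e _ = e _ ↔ _
  rw [hinj.eq_iff]
  simp

/-- The case in which the constant maps are endomorphisms: both detecting homomorphisms are taken to
be constant. -/
theorem hasZariskiOpenFibres_of_const {e : A × Bool → A} (he : IsSectionHom r e)
    (hinj : Function.Injective e) (hconst : ∀ a x y, r x y → r a a) :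
    HasZariskiOpenFibres r := by
  intro a b
  obtain ⟨p, q, hpq⟩ := he.exists_eq_iff_ne hinj b
  let k : r →r r := ⟨fun _ => a, fun {x y} h => hconst a x y h⟩
  exact isOpen_zariskiTopology_apply_eq (c := a) p q k k hpq rfl rfl fun _ _ _ _ => rfl

open Classical in
/-- The case in which two copies of `(A, r)` can be mapped to a part of `A` on which all
endomorphisms are injective: the detecting homomorphisms select copies that meet in `(a, false)` only. -/
theorem hasZariskiOpenFibres_of_injective
    (h : ∀ a, ∃ e : A × Bool → A, IsSectionHom r e ∧ e (a, false) = a ∧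
      ∀ s : r →r r, Function.Injective fun x => s (e x)) :
    HasZariskiOpenFibres r := by
  intro a b
  obtain ⟨e, he, hea, hs⟩ := h a
  have hinj : Function.Injective e := hs (RelHom.id r)
  obtain ⟨p, q, hpq⟩ := he.exists_eq_iff_ne hinj b
  refine isOpen_zariskiTopology_apply_eq (c := a) p q (he.toHom fun _ => false)
    (he.toHom fun x => decide (x ≠ a)) hpq hea (by simpa [IsSectionHom.toHom] using hea) ?_
  intro s x y hxy
  have := hs s hxy
  simp only [Prod.mk.injEq] at this
  obtain ⟨rfl, h⟩ := this
  have hx : x = a := by simpa using h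
  subst hx
  exact hea

end Fibres

/-! ### Embeddings into Fraïssé limits -/

section Random

open FirstOrder Language Structure

variable {P : ∀ B : Type u, (B → B → Prop) → Prop} {A : Type u} {r : A → A → Prop}

theorem IsRandom.restrict (h : IsRandom P r) {F : Set A} (hF : F.Finite) :
    P F (fun x y => r x y) := by
  obtain ⟨_, h⟩ := h
  let := relStructure r
  have := hF.to_subtype
  let S : Language.graph.Substructure A := ⟨F, fun f => isEmptyElim f⟩
  have hS : S.FG := Substructure.fg_iff_finite.2 (by assumption)
  have : CategoryTheory.Bundled.mk S ∈ finiteRelClass P := h.age ▸ age.fg_substructure hS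
  exact this.2

theorem IsRandom.exists_embedding (h : IsRandom P r) {B : Type u} [Countable B]
    (t : B → B → Prop) (hP : ∀ F : Set B, F.Finite → P F (fun x y => t x y))
    {F : Set B} (hF : F.Finite) (g : B → A) (hg : Set.InjOn g F)
    (hgr : ∀ x ∈ F, ∀ y ∈ F, t x y ↔ r (g x) (g y)) :
    ∃ e : B → A, Function.Injective e ∧ (∀ x y, t x y ↔ r (e x) (e y)) ∧ Set.EqOn e g F := by
  obtain ⟨_, h⟩ := h
  let := relStructure r
  let := relStructure t
  -- Finite substructures of `B` are in the age of `A`, so homogeneity of `A` yields one-point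
  -- extensions of finite partial embeddings.
  have ext : Language.graph.IsExtensionPair B A := by
    rw [isExtensionPair_iff_exists_embedding_closure_singleton_sup]
    intro S hS f m
    let T : Language.graph.Substructure B := Substructure.closure _ {m} ⊔ S
    have hT : T.FG := (Substructure.fg_closure_singleton m).sup hS
    have hfin : Finite T := hT.finite
    have hmem : CategoryTheory.Bundled.mk T ∈ Language.graph.age A := by
      rw [h.age]
      exact ⟨hfin, hP T (Set.toFinite _)⟩
    exact h.ultrahomogeneous.extend_embedding ((Substructure.fg_iff_structure_fg S).1 hS)
      (h := hmem.2) f _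
  have := hF.to_subtype
  let S : Language.graph.Substructure B := ⟨F, fun f => isEmptyElim f⟩
  have hS : S.FG := Substructure.fg_iff_finite.2 (by assumption)
  let f : S ↪[Language.graph] A :=
    { toFun := fun x => g x
      inj' := fun x y hxy => Subtype.ext (hg x.2 y.2 hxy)
      map_fun' := fun f => isEmptyElim f
      map_rel' := by
        rintro _ ⟨⟩ x
        exact (hgr _ (x 0).2 _ (x 1).2).symm }
  obtain ⟨e, he⟩ := embedding_from_cg (Structure.cg_iff_countable.2 inferInstance)
    ⟨⟨S, f.toHom.range, f.equivRange⟩, hS⟩ ext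
  refine ⟨e, e.injective, fun x y => (e.map_rel adj ![x, y]).symm, fun x hx => ?_⟩
  obtain ⟨_, hle⟩ := he
  exact DFunLike.congr_fun hle (⟨x, hx⟩ : S)

/-- An embedding of a countable structure into a random structure may be chosen to take a prescribed
value at one point. -/
theorem IsRandom.exists_embedding_apply_eq (h : IsRandom P r) {B : Type u} [Countable B]
    (t : B → B → Prop) (hP : ∀ F : Set B, F.Finite → P F (fun x y => t x y))
    (b : B) (a : A) (hba : t b b ↔ r a a) :
    ∃ e : B → A, Function.Injective e ∧ (∀ x y, t x y ↔ r (e x) (e y)) ∧ e b = a := by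
  obtain ⟨e, h₁, h₂, h₃⟩ := h.exists_embedding t hP (Set.finite_singleton b) (fun _ => a)
    (by simp) (by simpa using hba)
  exact ⟨e, h₁, h₂, h₃ rfl⟩

end Random

/-! ### Criteria for random structures -/

section Criteria

variable {P : ∀ B : Type u, (B → B → Prop) → Prop} {A : Type u} {r : A → A → Prop}

/-- Two copies of `(A, r)` in which the twins `(x, false)` and `(x, true)` are related to the other
points as `x` is, and are not related to each other. -/
def twinRel (r : A → A → Prop) (u v : A × Bool) : Prop :=
  r u.1 v.1 ∧ (u.1 = v.1 → u.2 = v.2)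

/-- The lexicographic product of `r` with the two-element strict chain. -/
def lexRel (r : A → A → Prop) (u v : A × Bool) : Prop :=
  r u.1 v.1 ∨ (u.1 = v.1 ∧ u.2 < v.2)

theorem isSectionHom_of_twinRel {e : A × Bool → A}
    (he : ∀ u v, twinRel r u v ↔ r (e u) (e v)) : IsSectionHom r e :=
  fun φ _ _ h => (he _ _).1 ⟨h, fun hxy => congrArg φ hxy⟩

theorem IsRandom.countable (h : IsRandom P r) : Countable A := h.1

theorem IsRandom.restrict_triple (h : IsRandom P r) (x y z : A) :
    P ({x, y, z} : Set A) (fun u v => r u v) :=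
  h.restrict (Set.toFinite _)

theorem IsRandom.hasZariskiOpenFibres_of_twinRel (h : IsRandom P r)
    (hP : ∀ F : Set (A × Bool), F.Finite → P F (fun u v => twinRel r u v))
    (hconst : ∀ a x y, r x y → r a a) : HasZariskiOpenFibres r := by
  have := h.countable
  obtain ⟨e, hinj, he, -⟩ := h.exists_embedding _ hP Set.finite_empty Prod.fst (by simp) (by simp)
  exact hasZariskiOpenFibres_of_const (isSectionHom_of_twinRel he) hinj hconst

/-- In an irreflexive structure, endomorphisms are injective on every image of a
structure in which any two distinct points are related. -/
theorem injective_comp_of_total {B : Type*} (hr : ∀ x, ¬ r x x) {t : B → B → Prop}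
    (ht : ∀ u v, u ≠ v → t u v ∨ t v u) {e : B → A} (he : ∀ u v, t u v → r (e u) (e v))
    (s : r →r r) : Function.Injective fun u => s (e u) := by
  intro u v huv
  by_contra hne
  change s (e u) = s (e v) at huv
  rcases ht u v hne with h | h
  · have := s.map_rel (he _ _ h)
    rw [huv] at this
    exact hr _ this
  · have := s.map_rel (he _ _ h)
    rw [huv] at this
    exact hr _ this

theorem IsRandom.hasZariskiOpenFibres_of_total (h : IsRandom P r) (hr : ∀ x, ¬ r x x)
    (t : A × Bool → A × Bool → Prop)
    (hP : ∀ F : Set (A × Bool), F.Finite → P F (fun u v => t u v))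
    (hirr : ∀ u, ¬ t u u) (ht : ∀ u v, u ≠ v → t u v ∨ t v u)
    (hrt : ∀ u v : A × Bool, r u.1 v.1 → t u v) : HasZariskiOpenFibres r := by
  have := h.countable
  refine hasZariskiOpenFibres_of_injective fun a => ?_
  obtain ⟨e, -, he, hea⟩ := h.exists_embedding_apply_eq t hP (a, false) a
    (iff_of_false (hirr _) (hr a))
  exact ⟨e, fun φ x y hxy => (he _ _).1 (hrt _ _ hxy), hea,
    injective_comp_of_total hr ht fun u v => (he u v).1⟩

end Criteria

/-! ### Orders -/

section Orders

variable {A : Type u} {r : A → A → Prop}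

/-- Two lexicographically interleaved copies of the rationals embed into the rationals. -/
theorem exists_orderEmbedding_ratLexBool : Nonempty (ℚ ×ₗ Bool ↪o ℚ) :=
  have : Countable (ℚ ×ₗ Bool) := inferInstanceAs (Countable (ℚ × Bool))
  Order.embedding_from_countable_to_dense _ _

theorem hasZariskiOpenFibres_of_ratLE (ι : r ≃r ((· ≤ ·) : ℚ → ℚ → Prop)) :
    HasZariskiOpenFibres r := by
  obtain ⟨j⟩ := exists_orderEmbedding_ratLexBool
  refine hasZariskiOpenFibres_of_const (e := fun u => ι.symm (j (toLex (ι u.1, u.2)))) ?_ ?_ ?_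
  · intro φ x y hxy
    refine ι.symm.map_rel_iff.2 (j.monotone ?_)
    rcases (ι.map_rel_iff.2 hxy).lt_or_eq with h | h
    · exact Prod.Lex.toLex_le_toLex.2 (Or.inl h)
    · rw [ι.injective h]
  · rintro ⟨x, i⟩ ⟨y, j⟩ h
    simpa using h
  · intro a _ _ _
    exact ι.map_rel_iff.1 le_rfl

theorem hasZariskiOpenFibres_of_ratLT (ι : r ≃r ((· < ·) : ℚ → ℚ → Prop)) :
    HasZariskiOpenFibres r := by
  obtain ⟨j⟩ := exists_orderEmbedding_ratLexBool
  refine hasZariskiOpenFibres_of_injective fun a => ?_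
  -- The translation moves the image of `(a, false)` to `a`.
  let e : A × Bool → A := fun u =>
    ι.symm (j (toLex (ι u.1, u.2)) - j (toLex (ι a, false)) + ι a)
  have he : ∀ u v : A × Bool, toLex (ι u.1, u.2) < toLex (ι v.1, v.2) → r (e u) (e v) := by
    intro u v h
    refine ι.symm.map_rel_iff.2 ?_
    have := j.strictMono h
    linarith
  refine ⟨e, fun φ x y hxy => he _ _ ?_, by simp [e], ?_⟩
  · exact Prod.Lex.toLex_lt_toLex.2 (Or.inl (ι.map_rel_iff.2 hxy))
  · refine injective_comp_of_total (fun x hx => lt_irrefl _ (ι.map_rel_iff.2 hx)) ?_ he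
    intro u v huv
    refine lt_or_gt_of_ne fun h => huv ?_
    simpa [Prod.ext_iff] using h

theorem IsRandom.hasZariskiOpenFibres_partialOrder
    (h : IsRandom (fun B s => IsPartialOrder B s) r) : HasZariskiOpenFibres r := by
  have hrefl : ∀ x, r x x := fun x =>
    (h.restrict_triple x x x).toIsPreorder.toRefl.refl ⟨x, by simp⟩
  have htrans : ∀ x y z, r x y → r y z → r x z := fun x y z =>
    (h.restrict_triple x y z).toIsPreorder.toIsTrans.trans ⟨x, by simp⟩ ⟨y, by simp⟩ ⟨z, by simp⟩
  have hanti : ∀ x y, r x y → r y x → x = y := fun x y hxy hyx =>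
    congrArg Subtype.val ((h.restrict_triple x y y).toAntisymm.antisymm ⟨x, by simp⟩ ⟨y, by simp⟩
      hxy hyx)
  refine h.hasZariskiOpenFibres_of_twinRel (fun F _ => ?_) fun a _ _ _ => hrefl a
  exact
    { refl := fun u => ⟨hrefl _, fun _ => rfl⟩
      trans := fun u v w huv hvw => ⟨htrans _ _ _ huv.1 hvw.1, fun huw => by
        have huv' : u.1.1 = v.1.1 := hanti _ _ huv.1 (by rw [huw]; exact hvw.1)
        rw [huv.2 huv', hvw.2 (huv'.symm.trans huw)]⟩
      antisymm := fun u v huv hvu => by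
        have := hanti _ _ huv.1 hvu.1
        exact Subtype.ext (Prod.ext this (huv.2 this)) }

theorem IsRandom.hasZariskiOpenFibres_strictOrder
    (h : IsRandom (fun B s => IsStrictOrder B s) r) : HasZariskiOpenFibres r := by
  have hirr : ∀ x, ¬ r x x := fun x =>
    (h.restrict_triple x x x).toIrrefl.irrefl ⟨x, by simp⟩
  have htrans : ∀ x y z, r x y → r y z → r x z := fun x y z =>
    (h.restrict_triple x y z).toIsTrans.trans ⟨x, by simp⟩ ⟨y, by simp⟩ ⟨z, by simp⟩
  have : IsPartialOrder A (fun x y => r x y ∨ x = y) :=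
    { refl := fun x => Or.inr rfl
      trans := by
        rintro x y z (hxy | rfl) (hyz | rfl)
        exacts [Or.inl (htrans _ _ _ hxy hyz), Or.inl hxy, Or.inl hyz, Or.inr rfl]
      antisymm := by
        rintro x y (hxy | rfl) (hyx | hyx)
        exacts [(hirr _ (htrans _ _ _ hxy hyx)).elim, hyx.symm, rfl, rfl] }
  -- A linear extension maps `r` into a chain, on which every endomorphism is injective.
  obtain ⟨l, hl, hrl⟩ := extend_partialOrder (fun x y => r x y ∨ x = y)
  have hlt : ∀ x y z, l x y → l y z → l x z := fun x y z => hl.toIsTrans.trans x y z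
  have hla : ∀ x y, l x y → l y x → x = y := fun x y => hl.toAntisymm.antisymm x y
  have hlT : ∀ x y, l x y ∨ l y x := fun x y => hl.toTotal.total x y
  have hIrr : ∀ u, ¬ lexRel (fun x y => l x y ∧ x ≠ y) u u := by
    rintro u (⟨-, h⟩ | ⟨-, h⟩)
    exacts [h rfl, lt_irrefl _ h]
  refine h.hasZariskiOpenFibres_of_total hirr (lexRel fun x y => l x y ∧ x ≠ y)
    (fun F _ => ?_) hIrr ?_ ?_
  · refine { irrefl := fun u => hIrr _, trans := ?_ }
    rintro ⟨⟨x, i⟩, _⟩ ⟨⟨y, j⟩, _⟩ ⟨⟨z, k⟩, _⟩ (⟨hxy, hne⟩ | ⟨hxy, hij⟩) (⟨hyz, hne'⟩ | ⟨hyz, hjk⟩)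
      <;> dsimp only at *
    · refine Or.inl ⟨hlt _ _ _ hxy hyz, fun hxz => hne (hla _ _ hxy ?_)⟩
      dsimp only at hxz
      rwa [hxz]
    · subst hyz
      exact Or.inl ⟨hxy, hne⟩
    · subst hxy
      exact Or.inl ⟨hyz, hne'⟩
    · exact Or.inr ⟨hxy.trans hyz, hij.trans hjk⟩
  · rintro ⟨x, i⟩ ⟨y, j⟩ huv
    by_cases hxy : x = y
    · subst hxy
      have hij : i ≠ j := fun hij => huv (by rw [hij])
      exact (lt_or_gt_of_ne hij).imp (fun h => Or.inr ⟨rfl, h⟩) fun h => Or.inr ⟨rfl, h⟩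
    · exact (hlT x y).imp (fun h => Or.inl ⟨h, hxy⟩) fun h => Or.inl ⟨h, Ne.symm hxy⟩
  · rintro u v huv
    exact Or.inl ⟨hrl _ _ (Or.inl huv), fun he => hirr _ (by rwa [he] at huv)⟩

theorem IsRandom.hasZariskiOpenFibres_tournament (h : IsRandom IsTournamentRel r) :
    HasZariskiOpenFibres r := by
  have hirr : ∀ x, ¬ r x x := fun x => (h.restrict_triple x x x).1 ⟨x, by simp⟩
  have htour : ∀ x y, x ≠ y → (r x y ↔ ¬ r y x) := fun x y hxy =>
    (h.restrict_triple x y y).2 ⟨x, by simp⟩ ⟨y, by simp⟩ fun he => hxy (congrArg Subtype.val he)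
  have hIrr : ∀ u, ¬ lexRel r u u := by
    rintro u (h | ⟨-, h⟩)
    exacts [hirr _ h, lt_irrefl _ h]
  have hTour : ∀ u v, u ≠ v → (lexRel r u v ↔ ¬ lexRel r v u) := by
    rintro ⟨x, i⟩ ⟨y, j⟩ huv
    by_cases hxy : x = y
    · subst hxy
      have hij : i ≠ j := fun hij => huv (by rw [hij])
      simp only [lexRel, hirr, false_or, true_and, not_lt]
      exact ⟨le_of_lt, fun h => lt_of_le_of_ne h hij⟩
    · simp [lexRel, hxy, Ne.symm hxy, htour x y hxy]
  refine h.hasZariskiOpenFibres_of_total hirr (lexRel r) (fun F _ => ⟨fun u => hIrr u,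
    fun u v huv => hTour u v fun he => huv (Subtype.ext he)⟩) hIrr (fun u v huv => ?_)
    fun u v huv => Or.inl huv
  rw [hTour u v huv]
  exact (em _).symm

end Orders

/-! ### Equivalence relations -/

section Equivalences

variable {A : Type u} {r : A → A → Prop}

theorem exists_injective_of_countable_of_infinite (B : Type*) {C : Type*} [Countable B] {S : Set C}
    (hS : S.Infinite) : ∃ f : B → C, Function.Injective f ∧ ∀ x, f x ∈ S := by
  have := hS.to_subtype
  obtain ⟨g, hg⟩ := exists_injective_nat B
  exact ⟨fun x => Infinite.natEmbedding S (g x),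
    Subtype.val_injective.comp ((Infinite.natEmbedding S).injective.comp hg), fun x => Subtype.prop _⟩

theorem IsEquivWithInfiniteClasses.hasZariskiOpenFibres (h : IsEquivWithInfiniteClasses r) :
    HasZariskiOpenFibres r := by
  obtain ⟨_, -, hr, hinf⟩ := h
  let S : Setoid A := ⟨r, hr⟩
  have hclass : ∀ q : Quotient S, {b | Quotient.mk S b = q}.Infinite := by
    intro q
    obtain ⟨a, rfl⟩ := Quotient.exists_rep q
    refine (hinf a).mono fun b hab => Quotient.sound (hr.symm hab)
  choose f hf hfm using fun q => exists_injective_of_countable_of_infinite (A × Bool) (hclass q)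
  -- The representative of `(x, i)` is chosen within the class of `x`.
  let e : A × Bool → A := fun u => f (Quotient.mk S u.1) u
  have he : ∀ u, Quotient.mk S (e u) = Quotient.mk S u.1 := fun u => hfm _ u
  refine hasZariskiOpenFibres_of_const (e := e) ?_ ?_ fun a _ _ _ => hr.refl a
  · intro φ x y hxy
    exact Quotient.exact ((he _).trans ((Quotient.sound hxy).trans (he (y, φ y)).symm))
  · intro u v huv
    have hq : Quotient.mk S u.1 = Quotient.mk S v.1 := by rw [← he u, ← he v, huv]
    change f (Quotient.mk S u.1) u = f (Quotient.mk S v.1) v at huv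
    rw [hq] at huv
    exact hf _ huv

open Classical in
theorem IsEquivWithInfiniteClasses.hasZariskiOpenFibres_ne {e : A → A → Prop}
    (he : IsEquivWithInfiniteClasses e) (hr : ∀ x y, r x y ↔ e x y ∧ x ≠ y) :
    HasZariskiOpenFibres r := by
  obtain ⟨_, -, heq, hinf⟩ := he
  refine hasZariskiOpenFibres_of_injective fun a => ?_
  obtain ⟨f, hf, hfm⟩ := exists_injective_of_countable_of_infinite (A × Bool) (hinf a)
  let g : A × Bool → A := fun u => Equiv.swap (f (a, false)) a (f u)
  have hg : ∀ u, e a (g u) := by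
    intro u
    change e a (Equiv.swap _ _ _)
    rw [Equiv.swap_apply_def]
    split_ifs
    exacts [heq.refl a, hfm _, hfm u]
  have hginj : Function.Injective g := (Equiv.injective _).comp hf
  have hgr : ∀ u v, u ≠ v → r (g u) (g v) := fun u v huv =>
    (hr _ _).2 ⟨heq.trans (heq.symm (hg u)) (hg v), hginj.ne huv⟩
  refine ⟨g, fun φ x y hxy => hgr _ _ fun h => ((hr x y).1 hxy).2 (congrArg Prod.fst h),
    Equiv.swap_apply_left _ _, ?_⟩
  exact injective_comp_of_total (fun x hx => ((hr x x).1 hx).2 rfl) (fun u v => Or.inl) hgr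

end Equivalences

/-! ### Graphs and digraphs -/

section Graphs

variable {A : Type u} {r : A → A → Prop}

theorem IsRandom.hasZariskiOpenFibres_graph (h : IsRandom IsGraph r) : HasZariskiOpenFibres r := by
  have hirr : ∀ x, ¬ r x x := fun x => (h.restrict_triple x x x).1 ⟨x, by simp⟩
  refine h.hasZariskiOpenFibres_of_total hirr (· ≠ ·)
    (fun F _ => ⟨fun u hu => hu rfl, fun u v => Ne.symm⟩) (fun u hu => hu rfl)
    (fun u v => Or.inl) fun u v huv he => hirr v.1 (by rwa [he] at huv)

theorem IsRandom.hasZariskiOpenFibres_digraph (h : IsRandom IsDigraph r) :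
    HasZariskiOpenFibres r := by
  have hirr : ∀ x, ¬ r x x := fun x => (h.restrict_triple x x x) ⟨x, by simp⟩
  refine h.hasZariskiOpenFibres_of_total hirr (· ≠ ·)
    (fun F _ u hu => hu rfl) (fun u hu => hu rfl)
    (fun u v => Or.inl) fun u v huv he => hirr v.1 (by rwa [he] at huv)

theorem IsRandom.hasZariskiOpenFibres_loopedGraph (h : IsRandom IsLoopedGraph r) :
    HasZariskiOpenFibres r := by
  have hrefl : ∀ x, r x x := fun x => (h.restrict_triple x x x).1 ⟨x, by simp⟩
  have hsymm : ∀ x y, r x y → r y x := fun x y =>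
    (h.restrict_triple x y y).2 ⟨x, by simp⟩ ⟨y, by simp⟩
  exact h.hasZariskiOpenFibres_of_twinRel
    (fun F _ => ⟨fun u => ⟨hrefl _, fun _ => rfl⟩,
      fun u v huv => ⟨hsymm _ _ huv.1, fun he => (huv.2 he.symm).symm⟩⟩)
    fun a _ _ _ => hrefl a

theorem IsRandom.hasZariskiOpenFibres_loopedDigraph (h : IsRandom IsLoopedDigraph r) :
    HasZariskiOpenFibres r := by
  have hrefl : ∀ x, r x x := fun x => (h.restrict_triple x x x) ⟨x, by simp⟩
  exact h.hasZariskiOpenFibres_of_twinRel (fun F _ u => ⟨hrefl _, fun _ => rfl⟩)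
    fun a _ _ _ => hrefl a

end Graphs

/-! ### Clique-free graphs -/

section CliqueFree

theorem hasNoClique_iff {n : ℕ} {B : Type*} {t : B → B → Prop} :
    HasNoClique n B t ↔
      ∀ f : Fin n → B, ¬ ∀ i j, i ≠ j → (SimpleGraph.fromRel t).Adj (f i) (f j) := by
  rw [HasNoClique, ← not_iff_not, SimpleGraph.not_cliqueFree_iff_top_isContained]
  push Not
  constructor
  · rintro ⟨f⟩
    exact ⟨f, fun i j hij => f.toHom.map_adj hij⟩
  · rintro ⟨f, hf⟩
    exact ⟨⟨⟨f, fun {i j} hij => hf i j hij⟩, fun i j hij => by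
      by_contra hne
      exact (hf i j hne).1 hij⟩⟩

theorem HasNoClique.of_map {n : ℕ} {B C : Type*} {t : B → B → Prop} {r : C → C → Prop}
    (h : HasNoClique n C r) (f : B → C)
    (hf : ∀ x y, x ≠ y → t x y → f x ≠ f y ∧ (r (f x) (f y) ∨ r (f y) (f x))) :
    HasNoClique n B t := by
  rw [hasNoClique_iff] at h ⊢
  refine fun g hg => h (f ∘ g) fun i j hij => ?_
  obtain ⟨hne, h₁ | h₁⟩ := hg i j hij
  · exact hf _ _ hne h₁
  · exact ⟨(hf _ _ hne.symm h₁).1.symm, (hf _ _ hne.symm h₁).2.symm⟩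

theorem hasNoClique_of_finite {n : ℕ} {B : Type*} {t : B → B → Prop}
    (h : ∀ F : Set B, F.Finite → HasNoClique n F (fun x y => t x y)) : HasNoClique n B t := by
  rw [hasNoClique_iff]
  intro f hf
  refine hasNoClique_iff.1 (h (Set.range f) (Set.finite_range f)) (fun i => ⟨f i, i, rfl⟩) ?_
  exact fun i j hij => ⟨fun he => (hf i j hij).1 (congrArg Subtype.val he), (hf i j hij).2⟩

theorem HasNoClique.subtype {n : ℕ} {B : Type*} {t : B → B → Prop} (h : HasNoClique n B t)
    (F : Set B) : HasNoClique n F (fun x y => t x y) :=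
  h.of_map Subtype.val fun _ _ hxy htxy => ⟨fun he => hxy (Subtype.ext he), Or.inl htxy⟩

theorem hasNoClique_of_card_lt {n : ℕ} {B : Type*} [Fintype B] (h : Fintype.card B < n)
    (t : B → B → Prop) : HasNoClique n B t :=
  SimpleGraph.cliqueFree_of_card_lt h

theorem HasNoClique.twinRel {n : ℕ} {A : Type*} {r : A → A → Prop} (h : HasNoClique n A r) :
    HasNoClique n (A × Bool) (twinRel r) :=
  h.of_map Prod.fst fun _ _ hxy hr => ⟨fun he => hxy (Prod.ext he (hr.2 he)), Or.inl hr.1⟩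

/-- A complete graph on `Fin (k + 2)`, together with two non-adjacent vertices `inl true` and
`inl false`: the former is adjacent to `inr 0`, the latter to all the other vertices of the complete
graph. Identifying these two vertices creates a clique on `k + 3` vertices. -/
def splitCliqueRel (k : ℕ) : Bool ⊕ Fin (k + 2) → Bool ⊕ Fin (k + 2) → Prop
  | .inl _, .inl _ => False
  | .inl b, .inr i => b = decide (i = 0)
  | .inr i, .inl b => b = decide (i = 0)
  | .inr i, .inr j => i ≠ j

theorem isGraph_splitCliqueRel (k : ℕ) : IsGraph _ (splitCliqueRel k) := by
  constructor
  · rintro (b | i) h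
    exacts [h, h rfl]
  · rintro (b | i) (c | j) h
    exacts [h, h, h, Ne.symm h]

theorem hasNoClique_splitCliqueRel (k : ℕ) : HasNoClique (k + 3) _ (splitCliqueRel k) := by
  -- The map is a proper colouring with `k + 2` colours.
  refine (hasNoClique_of_card_lt (B := Fin (k + 2)) (by simp) (· ≠ ·)).of_map
    (Sum.elim (fun b => if b then 1 else 0) id) fun x y _ hxy => ?_
  suffices h : Sum.elim (fun b => if b then 1 else 0) id x ≠
      Sum.elim (fun b => if b then (1 : Fin (k + 2)) else 0) id y from ⟨h, Or.inl h⟩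
  rcases x with b | i <;> rcases y with c | j
  · exact hxy.elim
  · change b = decide (j = 0) at hxy
    subst hxy
    by_cases hj : j = 0
    · simp [hj]
    · simpa [hj] using Ne.symm hj
  · change c = decide (i = 0) at hxy
    subst hxy
    by_cases hi : i = 0
    · simp [hi]
    · simp [hi]
  · exact hxy

variable {A : Type u} {r : A → A → Prop}

theorem IsRandom.hasZariskiOpenFibres_loopedCliqueFree {n : ℕ}
    (h : IsRandom (fun B s => IsLoopedGraph B s ∧ HasNoClique n B s) r) :
    HasZariskiOpenFibres r := by
  have hrefl : ∀ x, r x x := fun x => (h.restrict_triple x x x).1.1 ⟨x, by simp⟩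
  have hsymm : ∀ x y, r x y → r y x := fun x y =>
    (h.restrict_triple x y y).1.2 ⟨x, by simp⟩ ⟨y, by simp⟩
  have hcl : HasNoClique n A r := hasNoClique_of_finite fun F hF => (h.restrict hF).2
  exact h.hasZariskiOpenFibres_of_twinRel
    (fun F _ => ⟨⟨fun u => ⟨hrefl _, fun _ => rfl⟩,
      fun u v huv => ⟨hsymm _ _ huv.1, fun he => (huv.2 he.symm).symm⟩⟩, hcl.twinRel.subtype F⟩)
    fun a _ _ _ => hrefl a

/-- Endomorphisms of a random clique-free graph are injective if edges are allowed. Two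
non-adjacent points complete to a copy of `splitCliqueRel`, so that identifying them would create a clique. -/
theorem IsRandom.injective_of_cliqueFree {k : ℕ}
    (h : IsRandom (fun B s => IsGraph B s ∧ HasNoClique (k + 3) B s) r) (s : r →r r) :
    Function.Injective s := by
  have hirr : ∀ x, ¬ r x x := fun x => (h.restrict_triple x x x).1.1 ⟨x, by simp⟩
  have hsymm : ∀ x y, r x y → r y x := fun x y =>
    (h.restrict_triple x y y).1.2 ⟨x, by simp⟩ ⟨y, by simp⟩
  have hcl : HasNoClique (k + 3) A r := hasNoClique_of_finite fun F hF => (h.restrict hF).2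
  intro x y hxy
  by_contra hne
  have hrxy : ¬ r x y := fun hr => hirr (s y) (by simpa [hxy] using s.map_rel hr)
  have hryx : ¬ r y x := fun hr => hrxy (hsymm _ _ hr)
  -- The gadget is lifted to the universe of `A`.
  let B := ULift.{u} (Bool ⊕ Fin (k + 2))
  obtain ⟨e, -, he, heF⟩ := h.exists_embedding (B := B)
    (fun u v => splitCliqueRel k u.down v.down)
    (fun F _ => ⟨⟨fun u => (isGraph_splitCliqueRel k).1 _,
      fun u v => (isGraph_splitCliqueRel k).2 _ _⟩,
      ((hasNoClique_splitCliqueRel k).of_map ULift.down fun u v huv h =>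
        ⟨fun he => huv (ULift.ext _ _ he), Or.inl h⟩ : HasNoClique (k + 3) B _).subtype F⟩)
    (F := {⟨.inl true⟩, ⟨.inl false⟩}) (Set.toFinite _)
    (fun u => if u.down = .inl true then x else y)
    (by simp [Set.InjOn, hne, Ne.symm hne])
    (by simp [splitCliqueRel, hirr, hrxy, hryx])
  have hex : e ⟨.inl true⟩ = x := by simpa using heF (by simp : (⟨.inl true⟩ : B) ∈ _)
  have hey : e ⟨.inl false⟩ = y := by simpa using heF (by simp : (⟨.inl false⟩ : B) ∈ _)
  let w : Fin (k + 2) → A := fun i => s (e ⟨.inr i⟩)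
  have hw : ∀ i j, i ≠ j → r (w i) (w j) := fun i j hij => s.map_rel ((he _ _).1 hij)
  have hxw : ∀ i, r (s x) (w i) := by
    intro i
    by_cases hi : i = 0
    · rw [← hex]
      refine s.map_rel ((he _ _).1 ?_)
      simp [splitCliqueRel, hi]
    · rw [hxy, ← hey]
      refine s.map_rel ((he _ _).1 ?_)
      simp [splitCliqueRel, hi]
  have hadj : ∀ {u v}, r u v → (SimpleGraph.fromRel r).Adj u v := fun {u v} huv =>
    ⟨fun he => hirr v (by rwa [he] at huv), Or.inl huv⟩
  refine hasNoClique_iff.1 hcl (Fin.cons (s x) w) fun i j hij => hadj ?_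
  induction i using Fin.cases with
  | zero =>
    induction j using Fin.cases with
    | zero => exact (hij rfl).elim
    | succ j => exact hxw j
  | succ i =>
    induction j using Fin.cases with
    | zero => exact hsymm _ _ (hxw i)
    | succ j => exact hw i j fun h => hij (congrArg Fin.succ h)

theorem IsRandom.hasZariskiOpenFibres_cliqueFree {n : ℕ} (hn : 2 ≤ n)
    (h : IsRandom (fun B s => IsGraph B s ∧ HasNoClique n B s) r) : HasZariskiOpenFibres r := by
  have hirr : ∀ x, ¬ r x x := fun x => (h.restrict_triple x x x).1.1 ⟨x, by simp⟩
  have hsymm : ∀ x y, r x y → r y x := fun x y =>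
    (h.restrict_triple x y y).1.2 ⟨x, by simp⟩ ⟨y, by simp⟩
  have hcl : HasNoClique n A r := hasNoClique_of_finite fun F hF => (h.restrict hF).2
  have hP : ∀ F : Set (A × Bool), F.Finite →
      IsGraph F (fun u v => twinRel r u v) ∧ HasNoClique n F (fun u v => twinRel r u v) :=
    fun F _ => ⟨⟨fun u hu => hirr _ hu.1,
      fun u v huv => ⟨hsymm _ _ huv.1, fun he => (huv.2 he.symm).symm⟩⟩, hcl.twinRel.subtype F⟩
  obtain rfl | ⟨k, rfl⟩ : n = 2 ∨ ∃ k, n = k + 3 := by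
    rcases hn.eq_or_lt with h | h
    exacts [Or.inl h.symm, Or.inr ⟨n - 3, by omega⟩]
  · -- A graph without cliques of size two has no edges, so that all maps are endomorphisms.
    refine h.hasZariskiOpenFibres_of_twinRel hP fun a x y hxy => ?_
    have hadj : (SimpleGraph.fromRel r).Adj x y :=
      ⟨fun he => hirr y (by rwa [he] at hxy), Or.inl hxy⟩
    rw [HasNoClique, SimpleGraph.cliqueFree_two] at hcl
    rw [hcl] at hadj
    exact hadj.elim
  · have := h.countable
    refine hasZariskiOpenFibres_of_injective fun a => ?_
    obtain ⟨e, hinj, he, hea⟩ := h.exists_embedding_apply_eq (twinRel r) hP (a, false) a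
      (iff_of_false (fun hu => hirr _ hu.1) (hirr a))
    exact ⟨e, isSectionHom_of_twinRel he, hea, fun s => (h.injective_of_cliqueFree s).comp hinj⟩

end CliqueFree

/-! ### The listed structures -/

theorem IsListedStructure.hasZariskiOpenFibres {A : Type u} {r : A → A → Prop}
    (hr : IsListedStructure r) : HasZariskiOpenFibres r := by
  cases hr with
  | ratLE h => exact hasZariskiOpenFibres_of_ratLE h.some
  | partialOrder h => exact h.hasZariskiOpenFibres_partialOrder
  | equivalence h => exact h.hasZariskiOpenFibres
  | loopedGraph h => exact h.hasZariskiOpenFibres_loopedGraph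
  | loopedDigraph h => exact h.hasZariskiOpenFibres_loopedDigraph
  | loopedCliqueFree n hn h => exact h.hasZariskiOpenFibres_loopedCliqueFree
  | ratLT h => exact hasZariskiOpenFibres_of_ratLT h.some
  | strictPartialOrder h => exact h.hasZariskiOpenFibres_strictOrder
  | tournament h => exact h.hasZariskiOpenFibres_tournament
  | irreflEquivalence e he h => exact he.hasZariskiOpenFibres_ne h
  | graph h => exact h.hasZariskiOpenFibres_graph
  | digraph h => exact h.hasZariskiOpenFibres_digraph
  | cliqueFree n hn h => exact h.hasZariskiOpenFibres_cliqueFree hn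

/-- `r →r r` is the endomorphism monoid of `(A, r)`, with composition as multiplication.
In Mathlib's order on topologies `τ ≤ τ'` means that `τ` is finer than `τ'`, so that the
coarsest topology of a family is its greatest element. -/
theorem mainTheorem2 {A : Type u} (r : A → A → Prop) (hr : IsListedStructure r) :
    pointwiseTopology r = zariskiTopology (r →r r) ∧
      IsGreatest {τ : TopologicalSpace (r →r r) | @T2Space _ τ ∧ @ContinuousMul _ τ _}
        (pointwiseTopology r) := by
  have hT2 := t2Space_pointwiseTopology r
  have hmul := continuousMul_pointwiseTopology r
  have heq : pointwiseTopology r = zariskiTopology (r →r r) :=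
    le_antisymm (@le_zariskiTopology _ _ _ hT2 hmul)
      (le_pointwiseTopology_of_isOpen r _ hr.hasZariskiOpenFibres)
  refine ⟨heq, ⟨hT2, hmul⟩, ?_⟩
  rintro τ ⟨h₁, h₂⟩
  rw [heq]
  exact @le_zariskiTopology _ _ τ h₁ h₂
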